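/- Let $k\ge 1$ be an integer. The $k$-hyperopic game of cops and robber with $m$ cops on a graph $G$ is played as follows. The cops choose starting vertices, then the robber chooses a starting vertex. In each round the cops move first and then the robber moves; in a move, each cop (respectively the robber) stays put or moves to an adjacent vertex. The robber always has full information. When the robber is at $r$ and the cops are at $c_1,\dots,c_m$, the cops cannot see the robber if $1\le d(r,c_i)\le k$ for every $i$; otherwise they see his position. The cops win if after finitely many rounds some cop occupies the robber's vertex. The robber is omniscient, that is, he knows the strategy of the cops; so $m$ cops win on $G$ if and only if they have a strategy, in which each move depends only on what they have observed so far, that captures the robber whatever he does. The $k$-hyperopic cop number $c_{H,k}(G)$ is the least number of cops that win the game on $G$. A graph is outerplanar if it can be drawn in the plane without crossings so that all its vertices lie on the boundary of the outer face; equivalently, if it can be drawn without crossings in a closed disc, with its vertices on the bounding circle. **Theorem.** If $G$ is a finite connected outerplanar graph, then $c_{H,2}(G)\le 2$. -/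

import Mathlib

/-- A simple arc joining `p` to `q`: the image of an injective continuous path from `p` to `q`. -/
def IsSimpleArc (p q : ℂ) (s : Set ℂ) : Prop :=
  ∃ γ : Path p q, Function.Injective γ ∧ Set.range γ = s

/-- An outerplanar embedding of `G`: a crossing-free drawing in the closed unit disc, with the
vertices at distinct points of the bounding circle (so that every vertex lies on the boundary of the
outer face) and with the edges drawn as arbitrary simple arcs. -/
structure OuterplanarEmbedding {V : Type*} (G : SimpleGraph V) where
  /-- the point at which a vertex is placed -/
  point : V → ℂ
  /-- the curve that represents an edge (irrelevant for pairs that are not edges) -/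
  arc : Sym2 V → Set ℂ
  point_injective : Function.Injective point
  point_mem_circle : ∀ v, point v ∈ Metric.sphere (0 : ℂ) 1
  isSimpleArc : ∀ u v, G.Adj u v → IsSimpleArc (point u) (point v) (arc s(u, v))
  arc_subset_disc : ∀ e ∈ G.edgeSet, arc e ⊆ Metric.closedBall (0 : ℂ) 1
  /-- an edge passes through no vertices other than its two ends -/
  mem_of_point_mem_arc : ∀ e ∈ G.edgeSet, ∀ v, point v ∈ arc e → v ∈ e
  /-- two distinct edges meet only in common ends -/
  arc_inter_arc : ∀ e ∈ G.edgeSet, ∀ f ∈ G.edgeSet, e ≠ f →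
    arc e ∩ arc f ⊆ point '' {v | v ∈ e ∧ v ∈ f}

/-- A graph is outerplanar if it has an outerplanar embedding. -/
def IsOuterplanar {V : Type*} (G : SimpleGraph V) : Prop :=
  Nonempty (OuterplanarEmbedding G)

namespace HyperopicGame

variable {V : Type*}

/-- In one move, a player stays where they are or moves along an edge. -/
def Step (G : SimpleGraph V) (u v : V) : Prop :=
  v = u ∨ G.Adj u v

/-- With the cops at `c`, a robber at `r` is invisible if he is at distance at least `1` and at
most `k` from every cop. -/
def Invisible (G : SimpleGraph V) (k : ℕ) {m : ℕ} (c : Fin m → V) (r : V) : Prop :=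
  ∀ i, 1 ≤ G.edist r (c i) ∧ G.edist r (c i) ≤ k

open Classical in
/-- What the cops see: the position of the robber if he is visible, and nothing otherwise. -/
noncomputable def view (G : SimpleGraph V) (k : ℕ) {m : ℕ} (c : Fin m → V) (r : V) : Option V :=
  if Invisible G k c r then none else some r

/-- A strategy for `m` cops. A move may depend on everything that the cops have observed so far
(the list of their observations, the latest one first) and on their current positions. -/
structure CopStrategy (G : SimpleGraph V) (m : ℕ) where
  start : Fin m → V
  next : List (Option V) → (Fin m → V) → (Fin m → V)
  legal : ∀ h c i, Step G (c i) (next h c i)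

/-- The play of the strategy `S` in the `k`-hyperopic game against a robber who is at `r t` after
`t` rounds: the positions of the cops after `t` rounds, and the list of their observations.
The cops choose their starting positions first; every round consists of a move of the cops followed
by a move of the robber, and the cops observe after each of the two moves (and after the robber has
chosen his starting position). -/
noncomputable def play {G : SimpleGraph V} {m : ℕ} (S : CopStrategy G m) (k : ℕ) (r : ℕ → V) :
    ℕ → (Fin m → V) × List (Option V)
  | 0 => (S.start, [view G k S.start (r 0)])
  | t + 1 =>
    let c := (play S k r t).1
    let h := (play S k r t).2
    let c' := S.next h c
    (c', view G k c' (r (t + 1)) :: view G k c' (r t) :: h)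

/-- Some cop occupies the vertex of the robber after finitely many rounds, either at the end of a
round (or at the start of the game), or right after the cops' move in a round. -/
def Captured {G : SimpleGraph V} {m : ℕ} (S : CopStrategy G m) (k : ℕ) (r : ℕ → V) : Prop :=
  ∃ t i, (play S k r t).1 i = r t ∨ (play S k r (t + 1)).1 i = r t

/-- `m` cops win the `k`-hyperopic game on `G`. As the robber is omniscient (he knows the strategy of
the cops), the cops win if they have a strategy that captures every robber, whatever his moves. -/
def CopsWin (G : SimpleGraph V) (k m : ℕ) : Prop :=
  ∃ S : CopStrategy G m, ∀ r : ℕ → V, (∀ t, Step G (r t) (r (t + 1))) → Captured S k r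

/-- The `k`-hyperopic cop number: the least number of cops that win the `k`-hyperopic game on `G`
(and `⊤` if no finite number of cops wins). -/
noncomputable def hyperopicCopNumber (G : SimpleGraph V) (k : ℕ) : ℕ∞ :=
  ⨅ (m : ℕ) (_ : CopsWin G k m), (m : ℕ∞)

end HyperopicGame

/-!
The vertices of an outerplanar graph can be numbered along the bounding circle so that no two edges
have interleaved ends (`IsOuterplanar.exists_noncrossing`), because two curves in the disc whose
ends interleave on the circle meet (`exists_eq_of_interleaved`). In such a numbering an edge `aa'`
separates the vertices between `a` and `a'` from all others.

The robber is visible as soon as one cop is at distance at least three from him. So the cops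
proceed as follows: one of them stays and guards, while the other one looks around from a vertex so
far away that the robber would be visible in a certain part of his territory; then the territory
shrinks to that part or to the rest, according to whether the robber has been seen there.

In detail, let the cops at `a` and `b` confine the robber to the territory `Z` between `a` and `b`,
and let `a'` be the last neighbour of `a` in `Z`. If `b` has a neighbour `w` outside that is not
adjacent to `a`, the cop at `b` goes to `w`, from where every robber between `a` and `a'` is
visible (`Division.wins_of_not_adj`). A robber who is seen there is trapped behind the edge `aa'`
(`wins_of_edge`), and otherwise the cops go to `a'` and `b`. If there is no such `w`, for `a` and
`b` in either order, then whatever lies outside is attached through one common neighbour `w` of `a`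
and `b`, and a cop can look around from a neighbour of `w` (`Division.wins_of_unique`), unless
there is at most one vertex outside. The case that only one of `a` and `b` has a neighbour in `Z` is
similar (`Division.wins_of_single_exit`). Apart from the exception, which is excluded by `Roomy`,
the territory shrinks; and the exception does not arise later, since `a'` is adjacent to no vertex
outside `Z` but `a` and `b`. So the cops win by induction (`Guarded.wins`,
`wins_of_roomy_outside`).

It remains to reach some position with room behind the cops. A shortest edge that skips at least
two vertices spans a stretch of consecutive vertices with only very short edges inside
(`exists_stretch`), and at the beginning of this stretch the cops can clear a few vertices without
seeing the robber (`hasWinningStart_of_four_le`).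

A strategy depends on what the cops know of the robber's position. The predicate `Wins` describes
winning in terms of this knowledge, and `Wins.copsWin` turns it into a strategy in the sense of the
game, which replays the observations to compute the current knowledge.
-/

/-! ### Curves in the disc with interleaved ends -/

open Complex in
lemma arg_one_sub_exp_mul_I {θ : ℝ} (h₀ : 0 < θ) (h₁ : θ < 2 * Real.pi) :
    arg (1 - exp (θ * I)) = (θ - Real.pi) / 2 := by
  have key : 1 - exp (θ * I) =
      ((2 * Real.sin (θ / 2) : ℝ) : ℂ) * exp (((θ - Real.pi) / 2 : ℝ) * I) := by
    rw [exp_mul_I, exp_mul_I, ← ofReal_cos, ← ofReal_sin, ← ofReal_cos, ← ofReal_sin,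
      show (θ - Real.pi) / 2 = θ / 2 - Real.pi / 2 by ring, Real.cos_sub_pi_div_two,
      Real.sin_sub_pi_div_two]
    have hc : Real.cos θ = 1 - 2 * Real.sin (θ / 2) ^ 2 := by
      have := Real.cos_two_mul (θ / 2)
      rw [show 2 * (θ / 2) = θ by ring] at this
      nlinarith [Real.sin_sq_add_cos_sq (θ / 2)]
    have hs : Real.sin θ = 2 * Real.sin (θ / 2) * Real.cos (θ / 2) := by
      have := Real.sin_two_mul (θ / 2)
      rwa [show 2 * (θ / 2) = θ by ring] at this
    rw [hc, hs]
    push_cast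
    ring
  have hsin : 0 < 2 * Real.sin (θ / 2) := by
    have := Real.sin_pos_of_pos_of_lt_pi (x := θ / 2) (by linarith) (by linarith)
    linarith
  rw [key, arg_real_mul _ hsin, exp_mul_I, arg_cos_add_sin_mul_I]
  constructor <;> linarith [Real.pi_pos]

lemma one_sub_mem_slitPlane {z : ℂ} (hz : ‖z‖ ≤ 1) (h1 : z ≠ 1) : 1 - z ∈ Complex.slitPlane := by
  left
  have hre : z.re ≤ 1 := (Complex.re_le_norm z).trans hz
  rcases hre.lt_or_eq with h | h
  · simpa using h
  · exfalso
    apply h1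
    have h2 : z.re * z.re + z.im * z.im ≤ 1 := by
      have := Complex.sq_norm z
      rw [Complex.normSq_apply] at this
      nlinarith [norm_nonneg z]
    apply Complex.ext
    · simpa using h
    · have : z.im * z.im ≤ 0 := by rw [h] at h2; linarith
      simpa using mul_self_eq_zero.1 (le_antisymm this (mul_self_nonneg _))

open Complex in
/-- A continuous logarithm of `c * (1 - z t)`, where `z` stays in the closed unit disc and away
from `1`, changes its imaginary part exactly as the principal argument of `1 - z t` does. -/
lemma im_log_increment {l z : ℝ → ℂ} {c : ℂ} (hl : Continuous l) (hz : Continuous z)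
    (hz1 : ∀ t, ‖z t‖ ≤ 1) (hne : ∀ t, z t ≠ 1) (h : ∀ t, exp (l t) = c * (1 - z t)) :
    (l 1).im - (l 0).im = arg (1 - z 1) - arg (1 - z 0) := by
  have hcont : Continuous fun t ↦ l t - log (1 - z t) :=
    hl.sub <| Continuous.clog (by fun_prop) fun t ↦ one_sub_mem_slitPlane (hz1 t) (hne t)
  have hexp : ∀ t, exp (l t - log (1 - z t)) = c := by
    intro t
    have h0 : 1 - z t ≠ 0 := sub_ne_zero.2 (hne t).symm
    rw [exp_sub, exp_log h0, h, mul_div_assoc, div_self h0, mul_one]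
  have := isCoveringMap_exp.const_of_comp hcont
    (fun a a' ↦ Subtype.ext ((hexp a).trans (hexp a').symm)) 1 0
  have := congrArg Complex.im this
  simp only [sub_im, log_im] at this
  linarith

open Complex in
/-- Two curves in the closed unit disc whose ends interleave on the unit circle meet. If they did
not, the difference `γ s - δ t` would have a continuous logarithm on the square; but on each side of
the square one of the two points is fixed on the circle, so that the increments of the imaginary
part can be computed, and they add up to `2π` around the square. -/
theorem exists_eq_of_interleaved {γ δ : ℝ → ℂ} (hγ : Continuous γ) (hδ : Continuous δ)
    (hγ1 : ∀ t, ‖γ t‖ ≤ 1) (hδ1 : ∀ t, ‖δ t‖ ≤ 1) {a b c d : ℝ}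
    (hab : a < b) (hbc : b < c) (hcd : c < d) (hda : d < a + 2 * Real.pi)
    (hγa : γ 0 = exp (a * I)) (hγc : γ 1 = exp (c * I))
    (hδb : δ 0 = exp (b * I)) (hδd : δ 1 = exp (d * I)) : ∃ s t, γ s = δ t := by
  by_contra! hne
  have hunit : ∀ x : ℝ, ‖exp (x * I)‖ = 1 := fun x ↦ norm_exp_ofReal_mul_I x
  have hrot : ∀ x y : ℝ, exp (x * I) * exp (-(y * I)) = exp ((x - y : ℝ) * I) := by
    intro x y
    rw [← exp_add]
    congr 1
    push_cast
    ring
  have hrot' : ∀ x y : ℝ, exp (x * I) * exp (-(y * I)) = exp ((x - y + 2 * Real.pi : ℝ) * I) := by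
    intro x y
    rw [hrot, ← exp_periodic]
    congr 1
    push_cast
    ring
  have hcancel : ∀ (x : ℝ) (z : ℂ), exp (x * I) * (z * exp (-(x * I))) = z := by
    intro x z
    rw [exp_neg, mul_comm z, ← mul_assoc, mul_inv_cancel₀ (exp_ne_zero _), one_mul]
  have hnorm : ∀ (x : ℝ) (z : ℂ), ‖z‖ ≤ 1 → ‖z * exp (-(x * I))‖ ≤ 1 := by
    intro x z hz
    rw [norm_mul, exp_neg, norm_inv, hunit]
    simpa using hz
  have hone : ∀ (x : ℝ) (z : ℂ), z ≠ exp (x * I) → z * exp (-(x * I)) ≠ 1 := by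
    intro x z hz h
    apply hz
    rw [← hcancel x z, h, mul_one]
  let F : C(ℝ × ℝ, ℂ) := ⟨fun p ↦ γ p.1 - δ p.2, by fun_prop⟩
  have hF0 : ∀ p, F p ∈ ({0}ᶜ : Set ℂ) := fun p ↦ sub_ne_zero.2 (hne p.1 p.2)
  obtain ⟨L, ⟨-, hL⟩, -⟩ := isCoveringMapOn_exp.existsUnique_continuousMap_lifts F
    (a₀ := (0, 0)) (exp_log (hF0 (0, 0))) hF0
  have hL' : ∀ s t, exp (L (s, t)) = γ s - δ t := fun s t ↦ congrFun hL (s, t)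
  have e1 := im_log_increment (l := fun t ↦ L (0, t)) (z := fun t ↦ δ t * exp (-(a * I)))
    (c := exp (a * I)) (by fun_prop) (by fun_prop) (fun t ↦ hnorm _ _ (hδ1 t))
    (fun t ↦ hone _ _ (by rw [← hγa]; exact (hne 0 t).symm))
    (fun t ↦ by rw [hL', mul_sub, hcancel, hγa, mul_one])
  have e2 := im_log_increment (l := fun t ↦ L (1, t)) (z := fun t ↦ δ t * exp (-(c * I)))
    (c := exp (c * I)) (by fun_prop) (by fun_prop) (fun t ↦ hnorm _ _ (hδ1 t))
    (fun t ↦ hone _ _ (by rw [← hγc]; exact (hne 1 t).symm))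
    (fun t ↦ by rw [hL', mul_sub, hcancel, hγc, mul_one])
  have e3 := im_log_increment (l := fun s ↦ L (s, 0)) (z := fun s ↦ γ s * exp (-(b * I)))
    (c := -exp (b * I)) (by fun_prop) (by fun_prop) (fun s ↦ hnorm _ _ (hγ1 s))
    (fun s ↦ hone _ _ (by rw [← hδb]; exact hne s 0))
    (fun s ↦ by rw [hL', neg_mul, mul_sub, hcancel, hδb, mul_one, neg_sub])
  have e4 := im_log_increment (l := fun s ↦ L (s, 1)) (z := fun s ↦ γ s * exp (-(d * I)))
    (c := -exp (d * I)) (by fun_prop) (by fun_prop) (fun s ↦ hnorm _ _ (hγ1 s))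
    (fun s ↦ hone _ _ (by rw [← hδd]; exact hne s 1))
    (fun s ↦ by rw [hL', neg_mul, mul_sub, hcancel, hδd, mul_one, neg_sub])
  simp only [hγa, hγc, hδb, hδd] at e1 e2 e3 e4
  rw [hrot, hrot, arg_one_sub_exp_mul_I (by linarith) (by linarith),
    arg_one_sub_exp_mul_I (by linarith) (by linarith)] at e1
  rw [hrot, hrot', arg_one_sub_exp_mul_I (by linarith) (by linarith),
    arg_one_sub_exp_mul_I (by linarith) (by linarith)] at e2
  rw [hrot, hrot', arg_one_sub_exp_mul_I (by linarith) (by linarith),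
    arg_one_sub_exp_mul_I (by linarith) (by linarith)] at e3
  rw [hrot', hrot', arg_one_sub_exp_mul_I (by linarith) (by linarith),
    arg_one_sub_exp_mul_I (by linarith) (by linarith)] at e4
  linarith [Real.pi_pos]

/-! ### From outerplanar drawings to noncrossing numberings -/

/-- The numbering `f` of the vertices makes them the vertices of a convex polygon in which `G` is
drawn with straight edges: no two edges cross. -/
def Noncrossing {V : Type*} (G : SimpleGraph V) (f : V → ℤ) : Prop :=
  ∀ p q r s, f p < f q → f q < f r → f r < f s → G.Adj p r → ¬ G.Adj q s

/-- The vertices of an outerplanar graph, numbered in their order along the bounding circle. -/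
theorem IsOuterplanar.exists_noncrossing {V : Type*} [Finite V] {G : SimpleGraph V}
    (h : IsOuterplanar G) :
    ∃ e : V ≃ Fin (Nat.card V), Noncrossing G fun v ↦ (e v : ℕ) := by
  obtain ⟨E⟩ := h
  have hn : ∀ v, ‖E.point v‖ = 1 := fun v ↦ by simpa using E.point_mem_circle v
  have hexp : ∀ v, E.point v = Complex.exp ((E.point v).arg * Complex.I) := fun v ↦ by
    simpa [hn v] using (Complex.norm_mul_exp_arg_mul_I (E.point v)).symm
  have hinj : Function.Injective fun v ↦ (E.point v).arg := by
    intro u v huv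
    apply E.point_injective
    rw [hexp u, hexp v]
    simp only at huv
    rw [huv]
  have := Fintype.ofFinite V
  let _ : LinearOrder V := LinearOrder.lift' (fun v ↦ (E.point v).arg) hinj
  have hlt : ∀ u v : V, u < v ↔ (E.point u).arg < (E.point v).arg := fun u v ↦ Iff.rfl
  let e := (monoEquivOfFin V (Nat.card_eq_fintype_card (α := V)).symm).symm
  refine ⟨e.toEquiv, ?_⟩
  intro p q r s hpq hqr hrs hpr hqs
  have conv : ∀ u v : V, ((e.toEquiv u : ℕ) : ℤ) < (e.toEquiv v : ℕ) →
      (E.point u).arg < (E.point v).arg := by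
    intro u v huv
    rw [← hlt]
    have h2 : e u < e v := by
      rw [Fin.lt_def]
      exact_mod_cast huv
    exact e.lt_iff_lt.1 h2
  obtain ⟨γ, -, hγ⟩ := E.isSimpleArc p r hpr
  obtain ⟨δ, -, hδ⟩ := E.isSimpleArc q s hqs
  have hd : ∀ {u v : V}, G.Adj u v → ∀ {z}, z ∈ E.arc s(u, v) → ‖z‖ ≤ 1 := fun huv z hz ↦ by
    simpa using E.arc_subset_disc _ ((G.mem_edgeSet).2 huv) hz
  have hmemγ : ∀ t, γ.extend t ∈ E.arc s(p, r) := fun t ↦ by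
    rw [← hγ]; exact ⟨_, rfl⟩
  have hmemδ : ∀ t, δ.extend t ∈ E.arc s(q, s) := fun t ↦ by
    rw [← hδ]; exact ⟨_, rfl⟩
  have h1 := Complex.neg_pi_lt_arg (E.point p)
  have h2 := Complex.arg_le_pi (E.point s)
  obtain ⟨x, y, hxy⟩ := exists_eq_of_interleaved γ.continuous_extend δ.continuous_extend
    (fun t ↦ hd hpr (hmemγ t)) (fun t ↦ hd hqs (hmemδ t)) (conv _ _ hpq) (conv _ _ hqr)
    (conv _ _ hrs) (by linarith) (by rw [γ.extend_zero, ← hexp]) (by rw [γ.extend_one, ← hexp])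
    (by rw [δ.extend_zero, ← hexp]) (by rw [δ.extend_one, ← hexp])
  have hpq' : p ≠ q := by rintro rfl; exact lt_irrefl _ hpq
  have hqr' : q ≠ r := by rintro rfl; exact lt_irrefl _ hqr
  have hrs' : r ≠ s := by rintro rfl; exact lt_irrefl _ hrs
  have hps' : p ≠ s := by rintro rfl; exact lt_irrefl _ ((hpq.trans hqr).trans hrs)
  obtain ⟨v, ⟨hv1, hv2⟩, -⟩ := E.arc_inter_arc _ ((G.mem_edgeSet).2 hpr) _ ((G.mem_edgeSet).2 hqs)
    (by simp [hpq', hps']) ⟨hmemγ x, hxy ▸ hmemδ y⟩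
  rw [Sym2.mem_iff] at hv1 hv2
  rcases hv1 with rfl | rfl <;> rcases hv2 with h | h
  exacts [hpq' h, hps' h, hqr' h.symm, hrs' h]

namespace HyperopicGame

/-! ### Winning in terms of the cops' knowledge -/

section Knowledge

variable {V : Type*}

/-- `Wins G k c A`: cops at `c` who know nothing except that the robber, who has just moved, is in
`A` can capture him in the `k`-hyperopic game; what they see at this moment is not yet in use. They
win if `A` is empty; they may move, and then the robber may be wherever a robber in `A` could go
without meeting a cop; and they may use what they see: if all of a part `T` of `A` is visible, they
find out whether the robber is in `T`. -/
inductive Wins (G : SimpleGraph V) (k : ℕ) {m : ℕ} : (Fin m → V) → Set V → Prop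
  | empty (c) : Wins G k c ∅
  | move {c c' : Fin m → V} {A B : Set V} (hc : ∀ i, Step G (c i) (c' i))
      (hB : ∀ r ∈ A, (∀ i, c' i ≠ r) → ∀ r', Step G r r' → (∀ i, c' i ≠ r') → r' ∈ B)
      (h : Wins G k c' B) : Wins G k c A
  | split {c : Fin m → V} {A T : Set V} (hT : ∀ r ∈ A ∩ T, ¬ Invisible G k c r)
      (h₁ : Wins G k c (A ∩ T)) (h₂ : Wins G k c (A \ T)) : Wins G k c A

/-- The positions in which a robber from `A` may be after the cops have moved to `c'` and he has
answered, without being captured on the way. -/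
def escapes (G : SimpleGraph V) {m : ℕ} (c' : Fin m → V) (A : Set V) : Set V :=
  {r' | ∃ r ∈ A, (∀ i, c' i ≠ r) ∧ Step G r r' ∧ ∀ i, c' i ≠ r'}

/-- The part of `A` that agrees with the observation `o`. -/
def consistent (G : SimpleGraph V) (k : ℕ) {m : ℕ} (c : Fin m → V) (o : Option V) (A : Set V) :
    Set V :=
  {r ∈ A | view G k c r = o}

/-- The cops at `c`, who know that the robber is in `A`, can capture him within `n` rounds. Unlike
in `Wins`, what the cops see at this moment has been used already. -/
def WinsWithin (G : SimpleGraph V) (k : ℕ) {m : ℕ} : ℕ → (Fin m → V) → Set V → Prop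
  | 0, _, A => A = ∅
  | n + 1, c, A => ∃ c' : Fin m → V, (∀ i, Step G (c i) (c' i)) ∧
      ∀ o, WinsWithin G k n c' (consistent G k c' o (escapes G c' A))

variable {G : SimpleGraph V} {k m : ℕ}

lemma consistent_mono {c : Fin m → V} {o : Option V} {A B : Set V} (h : A ⊆ B) :
    consistent G k c o A ⊆ consistent G k c o B :=
  fun _ hr ↦ ⟨h hr.1, hr.2⟩

lemma escapes_mono {c : Fin m → V} {A B : Set V} (h : A ⊆ B) : escapes G c A ⊆ escapes G c B :=
  fun _ ⟨r, hr, h'⟩ ↦ ⟨r, h hr, h'⟩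

lemma WinsWithin.mono {n : ℕ} {c : Fin m → V} {A B : Set V} (hAB : A ⊆ B)
    (h : WinsWithin G k n c B) : WinsWithin G k n c A := by
  induction n generalizing c A B with
  | zero => exact Set.subset_eq_empty hAB h
  | succ n ih =>
    obtain ⟨c', hc, h⟩ := h
    exact ⟨c', hc, fun o ↦ ih (consistent_mono (escapes_mono hAB)) (h o)⟩

lemma WinsWithin.succ {n : ℕ} {c : Fin m → V} {A : Set V} (h : WinsWithin G k n c A) :
    WinsWithin G k (n + 1) c A := by
  induction n generalizing c A with
  | zero =>
    refine ⟨c, fun i ↦ Or.inl rfl, fun o ↦ Set.eq_empty_of_forall_notMem ?_⟩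
    rintro _ ⟨⟨r, hr, -⟩, -⟩
    have h' : A = ∅ := h
    simp [h'] at hr
  | succ n ih =>
    obtain ⟨c', hc, h⟩ := h
    exact ⟨c', hc, fun o ↦ ih (h o)⟩

lemma WinsWithin.le {n N : ℕ} (hnN : n ≤ N) {c : Fin m → V} {A : Set V}
    (h : WinsWithin G k n c A) : WinsWithin G k N c A := by
  induction hnN with
  | refl => exact h
  | step _ ih => exact ih.succ

/-- There are finitely many observations, so a bound on the number of rounds can be chosen that
does not depend on the observation. -/
theorem Wins.exists_winsWithin [Finite V] {c : Fin m → V} {A : Set V} (h : Wins G k c A) :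
    ∃ n, ∀ o, WinsWithin G k n c (consistent G k c o A) := by
  induction h with
  | empty c => exact ⟨0, fun o ↦ Set.eq_empty_of_forall_notMem fun r hr ↦ hr.1⟩
  | @move c c' A B hc hB _ ih =>
    obtain ⟨n, hn⟩ := ih
    refine ⟨n + 1, fun o ↦ ⟨c', hc, fun o' ↦ (hn o').mono (consistent_mono ?_)⟩⟩
    rintro r' ⟨r, hr, h1, h2, h3⟩
    exact hB r hr.1 h1 r' h2 h3
  | @split c A T hT _ _ ih₁ ih₂ =>
    obtain ⟨n₁, h₁⟩ := ih₁
    obtain ⟨n₂, h₂⟩ := ih₂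
    refine ⟨max n₁ n₂, fun o ↦ ?_⟩
    by_cases ho : ∃ r ∈ A ∩ T, view G k c r = o
    · obtain ⟨r, hr, rfl⟩ := ho
      refine ((h₁ (view G k c r)).mono ?_).le (le_max_left _ _)
      rintro s ⟨hs, hsr⟩
      -- the robber is seen at `r`, so he is there
      have : s = r := by
        by_cases hs' : Invisible G k c s
        · simp [view, hs', hT r hr] at hsr
        · simpa [view, hs', hT r hr] using hsr
      subst this
      exact ⟨hr, rfl⟩
    · refine ((h₂ o).mono ?_).le (le_max_right _ _)
      rintro s ⟨hs, hso⟩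
      exact ⟨⟨hs, fun hsT ↦ ho ⟨s, ⟨hs, hsT⟩, hso⟩⟩, hso⟩

open Classical in
/-- A move of the cops at `c`, who know that the robber is in `A`, that leads to the fastest
capture (and no move if a capture cannot be forced). -/
noncomputable def bestMove (G : SimpleGraph V) (k : ℕ) {m : ℕ} (c : Fin m → V) (A : Set V) :
    Fin m → V :=
  if h : ∃ n c', (∀ i, Step G (c i) (c' i)) ∧
      ∀ o, WinsWithin G k n c' (consistent G k c' o (escapes G c' A))
  then (Nat.find_spec h).choose else c

open Classical in
lemma bestMove_legal (c : Fin m → V) (A : Set V) (i : Fin m) :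
    Step G (c i) (bestMove G k c A i) := by
  unfold bestMove
  split_ifs with h
  · exact (Nat.find_spec h).choose_spec.1 i
  · exact Or.inl rfl

open Classical in
lemma WinsWithin.bestMove {n : ℕ} {c : Fin m → V} {A : Set V} (h : WinsWithin G k (n + 1) c A)
    (o : Option V) : WinsWithin G k n (bestMove G k c A)
      (consistent G k (HyperopicGame.bestMove G k c A) o
        (escapes G (HyperopicGame.bestMove G k c A) A)) := by
  unfold HyperopicGame.bestMove
  split_ifs with h'
  · exact ((Nat.find_spec h').choose_spec.2 o).le (Nat.find_min' h' h)
  · exact absurd ⟨n, h⟩ h'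

/-- The positions of the cops and what they know about the robber, computed from their observations,
when they start at `c`, know at first that the robber is in `A`, and always use `bestMove`. -/
noncomputable def belief (G : SimpleGraph V) (k : ℕ) {m : ℕ} (c : Fin m → V) (A : Set V) :
    List (Option V) → (Fin m → V) × Set V
  | [] => (c, A)
  | [o] => (c, consistent G k c o A)
  | o :: _ :: h =>
    let b := belief G k c A h
    let c' := bestMove G k b.1 b.2
    (c', consistent G k c' o (escapes G c' b.2))

theorem Wins.copsWin [Finite V] {c : Fin m → V} (h : Wins G k c {r | ∀ i, c i ≠ r}) :
    CopsWin G k m := by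
  obtain ⟨n, hn⟩ := h.exists_winsWithin
  let A : Set V := {r | ∀ i, c i ≠ r}
  let S : CopStrategy G m := {
    start := c
    next := fun h c' ↦ bestMove G k c' (belief G k c A h).2
    legal := fun h c' i ↦ bestMove_legal c' _ i }
  refine ⟨S, fun r hr ↦ ?_⟩
  by_contra hcap
  have hfree : ∀ t i, (play S k r t).1 i ≠ r t ∧ (play S k r (t + 1)).1 i ≠ r t := by
    intro t i
    constructor <;> intro h <;> exact hcap ⟨t, i, by tauto⟩
  -- as long as the robber is free, the belief is correct
  have hbelief : ∀ t, (belief G k c A (play S k r t).2).1 = (play S k r t).1 ∧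
      r t ∈ (belief G k c A (play S k r t).2).2 := by
    intro t
    induction t with
    | zero => exact ⟨rfl, fun i ↦ (hfree 0 i).1, rfl⟩
    | succ t ih =>
      have h1 : (belief G k c A (play S k r (t + 1)).2).1 = (play S k r (t + 1)).1 := by
        simp only [play, belief, ih.1]
        rfl
      refine ⟨h1, ?_⟩
      simp only [play, belief, ih.1]
      exact ⟨⟨r t, ih.2, fun i ↦ (hfree t i).2, hr t, fun i ↦ (hfree (t + 1) i).1⟩, rfl⟩
  have hrank : ∀ t ≤ n, WinsWithin G k (n - t) (play S k r t).1
      (belief G k c A (play S k r t).2).2 := by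
    intro t
    induction t with
    | zero => exact fun _ ↦ hn _
    | succ t ih =>
      intro ht
      have := ih (by omega)
      rw [show n - t = n - (t + 1) + 1 by omega] at this
      have h2 := this.bestMove (view G k (play S k r (t + 1)).1 (r (t + 1)))
      simp only [play, belief, (hbelief t).1]
      exact h2
  have h0 := hrank n le_rfl
  rw [Nat.sub_self] at h0
  have h1 := (hbelief n).2
  rw [show (belief G k c A (play S k r n).2).2 = ∅ from h0] at h1
  exact h1

end Knowledge

variable {V : Type*} {G : SimpleGraph V}

/-! ### Rules of play for two cops -/

section Rules

variable {k m : ℕ}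

lemma Wins.mono {c : Fin m → V} {A B : Set V} (hAB : A ⊆ B) (h : Wins G k c B) : Wins G k c A := by
  induction h generalizing A with
  | empty c => rw [Set.subset_empty_iff.1 hAB]; exact .empty c
  | move hc hB h _ => exact .move hc (fun r hr ↦ hB r (hAB hr)) h
  | split hT _ _ ih₁ ih₂ =>
    exact .split (fun r hr ↦ hT r ⟨hAB hr.1, hr.2⟩) (ih₁ (Set.inter_subset_inter_left _ hAB))
      (ih₂ (Set.sdiff_subset_sdiff_left hAB))

lemma Wins.perm {c : Fin m → V} {A : Set V} (σ : Equiv.Perm (Fin m)) (h : Wins G k c A) :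
    Wins G k (c ∘ σ) A := by
  induction h with
  | empty c => exact .empty _
  | move hc hB _ ih =>
    refine .move (fun i ↦ hc (σ i)) (fun r hr h1 r' h2 h3 ↦ hB r hr ?_ r' h2 ?_) ih
    · exact fun i ↦ by simpa using h1 (σ.symm i)
    · exact fun i ↦ by simpa using h3 (σ.symm i)
  | split hT _ _ ih₁ ih₂ =>
    exact .split (fun r hr hinv ↦ hT r hr fun i ↦ by simpa using hinv (σ.symm i)) ih₁ ih₂

/-- `Wins` in the `2`-hyperopic game with two cops at `x` and `y`. -/
abbrev Wins₂ (G : SimpleGraph V) (x y : V) (A : Set V) : Prop := Wins G 2 ![x, y] A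

lemma Wins₂.swap {x y : V} {A : Set V} (h : Wins₂ G x y A) : Wins₂ G y x A := by
  have := h.perm (Equiv.swap 0 1)
  convert this using 1
  ext i
  fin_cases i <;> simp

lemma Wins₂.move {x y : V} (x' y' : V) {A : Set V} (B : Set V) (hx : Step G x x') (hy : Step G y y')
    (hB : ∀ r ∈ A, r ≠ x' → r ≠ y' → ∀ r', Step G r r' → r' ≠ x' → r' ≠ y' → r' ∈ B)
    (h : Wins₂ G x' y' B) : Wins₂ G x y A := by
  refine Wins.move (c' := ![x', y']) (B := B) ?_ ?_ h
  · intro i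
    fin_cases i
    exacts [hx, hy]
  · intro r hr h1 r' h2 h3
    exact hB r hr (h1 0).symm (h1 1).symm r' h2 (h3 0).symm (h3 1).symm

/-- The distance of `x` and `r` is at least three. -/
def Far (G : SimpleGraph V) (x r : V) : Prop :=
  r ≠ x ∧ ¬ G.Adj r x ∧ ∀ y, G.Adj r y → ¬ G.Adj y x

lemma Far.two_lt_edist {x r : V} (h : Far G x r) : ¬ G.edist r x ≤ 2 := by
  intro hle
  have hne : G.edist r x ≠ ⊤ := fun h' ↦ by rw [h'] at hle; exact absurd hle (by decide)
  obtain ⟨p, hp⟩ := (SimpleGraph.reachable_of_edist_ne_top hne).exists_walk_length_eq_edist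
  rw [← hp] at hle
  have hle' : p.length ≤ 2 := by exact_mod_cast hle
  match p, hle' with
  | .nil, _ => exact h.1 rfl
  | .cons h1 .nil, _ => exact h.2.1 h1
  | .cons h1 (.cons h2 .nil), _ => exact h.2.2 _ h1 h2
  | .cons _ (.cons _ (.cons _ p)), hl => simp at hl

lemma Wins₂.split {x y : V} {A : Set V} (T : Set V) (hT : ∀ r ∈ A ∩ T, Far G y r)
    (h₁ : Wins₂ G x y (A ∩ T)) (h₂ : Wins₂ G x y (A \ T)) : Wins₂ G x y A :=
  Wins.split (fun r hr hinv ↦ (hT r hr).two_lt_edist (hinv 1).2) h₁ h₂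

end Rules

/-! ### Trapping the robber behind an edge, and dividing his territory -/

/-- Only `a` and `b` have to be guarded to keep a robber in `Z`. -/
def Confined (G : SimpleGraph V) (Z : Set V) (a b : V) : Prop :=
  ∀ z ∈ Z, ∀ v, G.Adj z v → v ∈ Z ∨ v = a ∨ v = b

/-- While one cop guards the only exit `b` of the robber's territory `Z`, the other one may go
wherever he wants. -/
lemma wins_of_single_exit (hconn : G.Connected) {Z : Set V} {a b : V} (hZ : Confined G Z b b)
    (h : Wins₂ G a b Z) (x : V) : Wins₂ G x b Z := by
  obtain ⟨p⟩ := hconn.preconnected x a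
  induction p with
  | nil => exact h
  | @cons x x' a hxx' _ ih =>
    refine Wins₂.move x' b Z (Or.inr hxx') (Or.inl rfl) ?_ (ih h)
    rintro r hr - - r' (rfl | hrr') - h4
    · exact hr
    · rcases hZ r hr r' hrr' with h | h | h
      exacts [h, absurd h h4, absurd h h4]

/-- A cop at `u` traps a robber behind the edge `uu'`: the cop captures him when he is seen on
`u'`, and meanwhile the other cop, coming from outside, approaches. As long as that cop is at
distance at least two from `u` and `u'`, he is so far from `Y` that the robber is visible there; and
once he is adjacent to `u` or `u'`, the two cops can occupy `u` and `u'` in one move. -/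
lemma wins_of_edge (hconn : G.Connected) {Y : Set V} {u u' : V} (huu' : G.Adj u u')
    (hY : Confined G Y u u') (h : Wins₂ G u u' Y) {x : V} (hx : x ∉ Y) :
    Wins₂ G u x (insert u' Y) := by
  have final : ∀ r ∈ insert u' Y, r ≠ u' → ∀ r', Step G r r' → r' ≠ u → r' ≠ u' → r' ∈ Y := by
    rintro r (rfl | hr) h2 r' hrr' h3 h4
    · exact absurd rfl h2
    · rcases hrr' with rfl | hrr'
      · exact hr
      · rcases hY r hr r' hrr' with h | h | h
        exacts [h, absurd h h3, absurd h h4]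
  induction hd : G.dist x u generalizing x with
  | zero =>
    obtain rfl : x = u := (hconn.dist_eq_zero_iff).1 hd
    exact Wins₂.move x u' Y (Or.inl rfl) (Or.inr huu')
      (fun r hr _ h2 r' hrr' h3 h4 ↦ final r hr h2 r' hrr' h3 h4) h
  | succ n ih =>
    by_cases hxu : G.Adj x u
    · exact Wins₂.move u' u Y (Or.inr huu') (Or.inr hxu)
        (fun r hr h1 _ r' hrr' h3 h4 ↦ final r hr h1 r' hrr' h4 h3) h.swap
    by_cases hxu' : Step G x u'
    · exact Wins₂.move u u' Y (Or.inl rfl) hxu'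
        (fun r hr _ h2 r' hrr' h3 h4 ↦ final r hr h2 r' hrr' h3 h4) h
    have hxne : x ≠ u := by
      rintro rfl
      simp at hd
    have hx' : ∀ v, G.Adj v x → v ∉ Y := by
      intro v hv hvY
      rcases hY v hvY x hv with h | h | h
      · exact hx h
      · exact hxne h
      · exact hxu' (Or.inl h.symm)
    refine Wins₂.split Y ?_ ?_ ?_
    · rintro r ⟨-, hr⟩
      refine ⟨fun h ↦ hx (h ▸ hr), fun h ↦ hx' r h hr, fun y hry hyx ↦ ?_⟩
      rcases hY r hr y hry with h | h | h
      · exact hx' y hyx h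
      · exact hxu (h ▸ hyx.symm)
      · exact hxu' (Or.inr (h ▸ hyx.symm))
    · obtain ⟨p, hp⟩ := (hconn.preconnected x u).exists_walk_length_eq_dist
      cases p with
      | nil => exact absurd rfl hxne
      | @cons _ y _ hxy p =>
        have hyn : G.dist y u = n := by
          have h1 := SimpleGraph.dist_le p
          have h2 := hconn.dist_triangle (u := x) (v := y) (w := u)
          rw [SimpleGraph.dist_eq_one_iff_adj.2 hxy] at h2
          rw [SimpleGraph.Walk.length_cons] at hp
          omega
        refine Wins₂.move u y (insert u' Y) (Or.inl rfl) (Or.inr hxy) ?_ (ih (hx' y hxy.symm) hyn)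
        rintro r ⟨-, hr⟩ - - r' (rfl | hrr') h3 -
        · exact Or.inr hr
        · rcases hY r hr r' hrr' with h | h | h
          exacts [Or.inr h, absurd h h3, Or.inl h]
    · refine Wins₂.move u' x ∅ (Or.inr huu') (Or.inl rfl) ?_ (.empty _)
      rintro r ⟨rfl | hr, hr'⟩ h1
      · exact absurd rfl h1
      · exact absurd hr hr'

/-- The vertices that lie strictly between `a` and `b` in the numbering `f`. -/
def between (f : V → ℤ) (a b : V) : Set V := {z | f a < f z ∧ f z < f b}

lemma _root_.Noncrossing.neg {f : V → ℤ} (hf : Noncrossing G f) : Noncrossing G fun v ↦ -f v :=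
  fun p q r s h1 h2 h3 hpr hqs ↦
    hf s r q p (by linarith) (by linarith) (by linarith) hqs.symm hpr.symm

lemma between_neg (f : V → ℤ) (a b : V) : between (fun v ↦ -f v) b a = between f a b := by
  ext z
  simp [between, and_comm]

lemma Confined.symm {Z : Set V} {a b : V} (h : Confined G Z a b) : Confined G Z b a :=
  fun z hz v hzv ↦ by rcases h z hz v hzv with h | h | h <;> tauto

/-- The configuration in which the territory between `a` and `b` is divided by the last neighbour
`a'` of `a` in it. -/
structure Division (G : SimpleGraph V) (f : V → ℤ) (a b a' : V) : Prop where
  inj : Function.Injective f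
  noncrossing : Noncrossing G f
  confined : Confined G (between f a b) a b
  mem : a' ∈ between f a b
  adj : G.Adj a a'
  le_of_adj : ∀ z ∈ between f a b, G.Adj a z → f z ≤ f a'

namespace Division

variable {f : V → ℤ} {a b a' : V} (D : Division G f a b a')
include D

lemma cases {z : V} (hz : z ∈ between f a b) :
    z ∈ between f a a' ∨ z = a' ∨ z ∈ between f a' b := by
  rcases lt_trichotomy (f z) (f a') with h | h | h
  · exact Or.inl ⟨hz.1, h⟩
  · exact Or.inr (Or.inl (D.inj h))
  · exact Or.inr (Or.inr ⟨h, hz.2⟩)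

lemma left_subset : between f a a' ⊆ between f a b := fun _ hz ↦ ⟨hz.1, hz.2.trans D.mem.2⟩

lemma right_subset : between f a' b ⊆ between f a b := fun _ hz ↦ ⟨D.mem.1.trans hz.1, hz.2⟩

lemma not_adj_right {z : V} (hz : z ∈ between f a' b) : ¬ G.Adj a z := fun h ↦
  absurd (D.le_of_adj z (D.right_subset hz) h) (not_le.2 hz.1)

lemma confined_left : Confined G (between f a a') a a' := by
  intro z hz v hzv
  rcases D.confined z (D.left_subset hz) v hzv with h | h | h
  · rcases D.cases h with h | h | h
    · exact Or.inl h
    · exact Or.inr (Or.inr h)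
    · exact absurd hzv (D.noncrossing a z a' v hz.1 hz.2 h.1 D.adj)
  · exact Or.inr (Or.inl h)
  · subst h
    exact absurd hzv (D.noncrossing a z a' v hz.1 hz.2 D.mem.2 D.adj)

lemma confined_right : Confined G (between f a' b) a' b := by
  intro z hz v hzv
  rcases D.confined z (D.right_subset hz) v hzv with h | h | h
  · rcases D.cases h with h | h | h
    · exact absurd hzv.symm (D.noncrossing a v a' z h.1 h.2 hz.1 D.adj)
    · exact Or.inr (Or.inl h)
    · exact Or.inl h
  · subst h
    exact absurd hzv.symm (D.not_adj_right hz)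
  · exact Or.inr (Or.inr h)

lemma not_adj_left {z : V} (hz : z ∈ between f a a') : ¬ G.Adj z b :=
  D.noncrossing a z a' b hz.1 hz.2 D.mem.2 D.adj

/-- If `b` has a neighbour `w` outside the territory that is not adjacent to `a`, a cop looks around
from `w`: from there he sees every robber between `a` and `a'`. -/
lemma wins_of_not_adj (hconn : G.Connected) (h₁ : Wins₂ G a a' (between f a a'))
    (h₂ : Wins₂ G a' b (between f a' b)) {w : V} (hwb : G.Adj w b) (hwa : ¬ G.Adj w a)
    (hw : w ∉ between f a b) (hne : w ≠ a) : Wins₂ G a b (between f a b) := by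
  refine Wins₂.move a w (insert b (between f a b)) (Or.inl rfl) (Or.inr hwb.symm) ?_ ?_
  · rintro r hr - - r' (rfl | hrr') h3 -
    · exact Or.inr hr
    · rcases D.confined r hr r' hrr' with h | h | h
      exacts [Or.inr h, absurd h h3, Or.inl h]
  have hwZ : ∀ v ∈ between f a b, ¬ G.Adj v w := by
    intro v hv hvw
    rcases D.confined v hv w hvw with h | h | h
    exacts [hw h, hne h, hwb.ne h]
  refine Wins₂.split (between f a a') ?_ ?_ ?_
  · rintro r ⟨-, hr⟩
    refine ⟨fun h ↦ hw (h ▸ D.left_subset hr), hwZ r (D.left_subset hr), fun y hry hyw ↦ ?_⟩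
    rcases D.confined_left r hr y hry with h | h | h
    · exact hwZ y (D.left_subset h) hyw
    · exact hwa (h ▸ hyw.symm)
    · exact hwZ y (h ▸ D.mem) hyw
  · exact (wins_of_edge hconn D.adj D.confined_left h₁ fun h ↦ hw (D.left_subset h)).mono
      fun r hr ↦ Or.inr hr.2
  · refine Wins₂.move a' b (between f a' b) (Or.inr D.adj) (Or.inr hwb) ?_ h₂
    rintro r ⟨hr, hr'⟩ h1 h2 r' hrr' h3 h4
    have hr2 : r ∈ between f a' b := by
      rcases hr with h | h
      · exact absurd h h2
      · rcases D.cases h with h | h | h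
        exacts [absurd h hr', absurd h h1, h]
    rcases hrr' with rfl | hrr'
    · exact hr2
    · rcases D.confined_right r hr2 r' hrr' with h | h | h
      exacts [h, absurd h h3, absurd h h4]

/-- If `w` is the only neighbour of `b` outside the territory, and `w₂` is a vertex behind `w`, a
cop looks around from `w₂`: from there he sees every robber between `a` and `a'`, and a robber who
meanwhile slipped out through `b` has to face him when he comes back. -/
lemma wins_of_unique (hconn : G.Connected) (h₁ : Wins₂ G a a' (between f a a'))
    (h₂ : Wins₂ G a' b (between f a' b)) {w w₂ : V} (hwb : G.Adj w b)
    (huniq : ∀ v, G.Adj b v → v ∈ between f a b ∨ v = a ∨ v = w) (hww₂ : G.Adj w w₂)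
    (hw₂ : w₂ ∉ between f a b) (hw₂a : ¬ G.Adj w₂ a) (hw₂b : ¬ G.Adj w₂ b)
    (hne : w₂ ≠ a) (hneb : w₂ ≠ b) : Wins₂ G a b (between f a b) := by
  -- to `w`: the robber may reach `b`
  refine Wins₂.move a w (insert b (between f a b)) (Or.inl rfl) (Or.inr hwb.symm) ?_ ?_
  · rintro r hr - - r' (rfl | hrr') h3 -
    · exact Or.inr hr
    · rcases D.confined r hr r' hrr' with h | h | h
      exacts [Or.inr h, absurd h h3, Or.inl h]
  -- to `w₂`: a robber at `b` may reach `w`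
  refine Wins₂.move a w₂ (insert w (insert b (between f a b))) (Or.inl rfl) (Or.inr hww₂) ?_ ?_
  · rintro r hr - - r' (rfl | hrr') h3 -
    · exact Or.inr hr
    · rcases hr with rfl | hr
      · rcases huniq r' hrr' with h | h | h
        exacts [Or.inr (Or.inr h), absurd h h3, Or.inl h]
      · rcases D.confined r hr r' hrr' with h | h | h
        exacts [Or.inr (Or.inr h), absurd h h3, Or.inr (Or.inl h)]
  have hw₂Z : ∀ v ∈ between f a b, ¬ G.Adj v w₂ := by
    intro v hv hvw
    rcases D.confined v hv w₂ hvw with h | h | h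
    exacts [hw₂ h, hne h, hneb h]
  have hsub : ∀ r ∈ insert a' (between f a a'), r ∈ between f a b := by
    rintro r (rfl | hr)
    exacts [D.mem, D.left_subset hr]
  refine Wins₂.split (insert a' (between f a a')) ?_ ?_ ?_
  · rintro r ⟨-, hr⟩
    refine ⟨fun h ↦ hw₂ (h ▸ hsub r hr), hw₂Z r (hsub r hr), fun y hry hyw ↦ ?_⟩
    rcases D.confined r (hsub r hr) y hry with h | h | h
    · exact hw₂Z y h hyw
    · exact hw₂a (h ▸ hyw.symm)
    · exact hw₂b (h ▸ hyw.symm)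
  · exact (wins_of_edge hconn D.adj D.confined_left h₁ fun h ↦ hw₂ (D.left_subset h)).mono
      fun r hr ↦ hr.2
  -- not seen: back to `w`, where a robber who went that far is captured
  refine Wins₂.move a w (insert a' (insert b (between f a' b))) (Or.inl rfl) (Or.inr hww₂.symm)
    ?_ ?_
  · rintro r ⟨hr, hr'⟩ - h2 r' hrr' h3 h4
    have hr2 : r = b ∨ r ∈ between f a' b := by
      rcases hr with h | h | h
      · exact absurd h h2
      · exact Or.inl h
      · rcases D.cases h with h | h | h
        exacts [absurd (Or.inr h) hr', absurd (Or.inl h) hr', Or.inr h]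
    rcases hrr' with rfl | hrr'
    · exact Or.inr hr2
    · rcases hr2 with rfl | hr2
      · rcases huniq r' hrr' with h | h | h
        · rcases D.cases h with h | h | h
          exacts [absurd hrr'.symm (D.not_adj_left h), Or.inl h, Or.inr (Or.inr h)]
        · exact absurd h h3
        · exact absurd h h4
      · rcases D.confined_right r hr2 r' hrr' with h | h | h
        exacts [Or.inr (Or.inr h), Or.inl h, Or.inr (Or.inl h)]
  · refine Wins₂.move a' b (between f a' b) (Or.inr D.adj) (Or.inr hwb) ?_ h₂
    rintro r hr h1 h2 r' hrr' h3 h4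
    have hr2 : r ∈ between f a' b := by
      rcases hr with h | h | h
      exacts [absurd h h1, absurd h h2, h]
    rcases hrr' with rfl | hrr'
    · exact hr2
    · rcases D.confined_right r hr2 r' hrr' with h | h | h
      exacts [h, absurd h h3, absurd h h4]

/-- If `b` is not adjacent to the territory, `a` is its only exit, and the cop at `b` is free to go
to `a'`. From there he shuts in every robber between `a'` and `b`, and the cop at `a` can look
around from a neighbour `w` outside, from where a robber between `a'` and `b` is visible. -/
lemma wins_of_single_exit (hconn : G.Connected) (h₁ : Wins₂ G a a' (between f a a'))
    (h₂ : Wins₂ G a' b (between f a' b)) (hb : ∀ z ∈ between f a b, ¬ G.Adj b z) {w : V}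
    (hwa : G.Adj w a) (hw : w ∉ between f a b) : Wins₂ G a b (between f a b) := by
  have hZ : ∀ r ∈ between f a b, ∀ r', Step G r r' → r' ∈ between f a b ∨ r' = a := by
    rintro r hr r' (rfl | hrr')
    · exact Or.inl hr
    · rcases D.confined r hr r' hrr' with h | h | h
      · exact Or.inl h
      · exact Or.inr h
      · exact absurd (h ▸ hrr'.symm) (hb r hr)
  have hR : ∀ r ∈ between f a' b, ∀ r', Step G r r' → r' ∈ between f a' b ∨ r' = a' := by
    rintro r hr r' (rfl | hrr')
    · exact Or.inl hr
    · rcases D.confined_right r hr r' hrr' with h | h | h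
      · exact Or.inl h
      · exact Or.inr h
      · exact absurd (h ▸ hrr'.symm) (hb r (D.right_subset hr))
  have hL : ∀ r ∈ between f a a', ∀ r', Step G r r' → r' ∈ between f a a' ∨ r' = a ∨ r' = a' := by
    rintro r hr r' (rfl | hrr')
    · exact Or.inl hr
    · exact D.confined_left r hr r' hrr'
  have hwZ : ∀ v ∈ between f a b, ¬ G.Adj v w := by
    intro v hv hvw
    rcases hZ v hv w (Or.inr hvw) with h | h
    exacts [hw h, hwa.ne h]
  have hwR : ∀ r ∈ between f a' b, Far G w r := by
    intro r hr
    refine ⟨fun h ↦ hw (h ▸ D.right_subset hr), hwZ r (D.right_subset hr), fun y hry hyw ↦ ?_⟩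
    rcases hR r hr y (Or.inr hry) with h | h
    · exact hwZ y (D.right_subset h) hyw
    · exact hwZ y (h ▸ D.mem) hyw
  -- the position with the free cop at `a'`; he gets there while the cop at `a` guards the exit
  have key : Wins₂ G a a' (between f a b) := by
    refine Wins₂.move w a' (insert a (between f a b)) (Or.inr hwa.symm) (Or.inl rfl) ?_ ?_
    · rintro r hr - - r' hrr' - -
      rcases hZ r hr r' hrr' with h | h
      exacts [Or.inr h, Or.inl h]
    refine Wins₂.swap (Wins₂.split (between f a' b) (fun r hr ↦ hwR r hr.2) ?_ ?_)
    · have hexit : Confined G (between f a' b) a' a' := fun r hr v hrv ↦ by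
        rcases hR r hr v (Or.inr hrv) with h | h
        exacts [Or.inl h, Or.inr (Or.inl h)]
      exact ((HyperopicGame.wins_of_single_exit hconn hexit h₂.swap w).swap).mono fun r hr ↦ hr.2
    · refine Wins₂.move a' a (between f a a') (Or.inl rfl) (Or.inr hwa) ?_ h₁.swap
      rintro r ⟨hr, hr'⟩ h1 h2 r' hrr' h3 h4
      have hr2 : r ∈ between f a a' := by
        rcases hr with h | h
        · exact absurd h h2
        · rcases D.cases h with h | h | h
          exacts [h, absurd h h1, absurd h hr']
      rcases hL r hr2 r' hrr' with h | h | h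
      exacts [h, absurd h h4, absurd h h3]
  have hexit : Confined G (between f a b) a a := fun r hr v hrv ↦ by
    rcases hZ r hr v (Or.inr hrv) with h | h
    exacts [Or.inl h, Or.inr (Or.inl h)]
  exact (HyperopicGame.wins_of_single_exit hconn hexit key.swap b).swap

end Division

/-! ### Territories with room behind the cops -/

/-- There is room behind the two cops at `a` and `b` who confine the robber to `Z`: some vertex
besides `a`, `b` and the territory is not a common neighbour of `a` and `b`, or one of `a` and `b`
does not have to be guarded. -/
def Roomy (G : SimpleGraph V) (Z : Set V) (a b : V) : Prop :=
  (∃ w ∉ Z, w ≠ a ∧ w ≠ b ∧ ¬ (G.Adj w a ∧ G.Adj w b)) ∨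
    (∀ z ∈ Z, ¬ G.Adj a z) ∨ (∀ z ∈ Z, ¬ G.Adj b z)

lemma Roomy.symm {Z : Set V} {a b : V} (h : Roomy G Z a b) : Roomy G Z b a := by
  rcases h with ⟨w, h1, h2, h3, h4⟩ | h | h
  · exact Or.inl ⟨w, h1, h3, h2, fun h ↦ h4 h.symm⟩
  · exact Or.inr (Or.inr h)
  · exact Or.inr (Or.inl h)

/-- `Z` is the territory between `a` and `b`, which two cops at `a` and `b` with room behind them
confine the robber to. -/
structure Guarded (G : SimpleGraph V) (f : V → ℤ) (a b : V) : Prop where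
  inj : Function.Injective f
  noncrossing : Noncrossing G f
  lt : f a < f b
  confined : Confined G (between f a b) a b
  roomy : Roomy G (between f a b) a b

lemma Guarded.neg {f : V → ℤ} {a b : V} (h : Guarded G f a b) :
    Guarded G (fun v ↦ -f v) b a where
  inj := fun _ _ huv ↦ h.inj (neg_injective huv)
  noncrossing := h.noncrossing.neg
  lt := neg_lt_neg h.lt
  confined := by rw [between_neg]; exact h.confined.symm
  roomy := by rw [between_neg]; exact h.roomy.symm

lemma Division.guarded_left {f : V → ℤ} {a b a' w : V} (D : Division G f a b a')
    (hw : w ∉ between f a b) (hwa : w ≠ a) (h : ¬ G.Adj w a') : Guarded G f a a' where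
  inj := D.inj
  noncrossing := D.noncrossing
  lt := D.mem.1
  confined := D.confined_left
  roomy := Or.inl ⟨w, fun h' ↦ hw (D.left_subset h'), hwa, fun h' ↦ hw (h' ▸ D.mem),
    fun h' ↦ h h'.2⟩

lemma Division.guarded_right {f : V → ℤ} {a b a' : V} (D : Division G f a b a')
    (h : Roomy G (between f a' b) a' b) : Guarded G f a' b where
  inj := D.inj
  noncrossing := D.noncrossing
  lt := D.mem.2
  confined := D.confined_right
  roomy := h

lemma Division.not_adj_of_notMem {f : V → ℤ} {a b a' w : V} (D : Division G f a b a')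
    (hw : w ∉ between f a b) (hwa : w ≠ a) (hwb : w ≠ b) : ¬ G.Adj w a' := fun h ↦ by
  rcases D.confined a' D.mem w h.symm with h | h | h
  exacts [hw h, hwa h, hwb h]

lemma Division.ncard_left_lt [Finite V] {f : V → ℤ} {a b a' : V} (D : Division G f a b a') :
    (between f a a').ncard < (between f a b).ncard :=
  Set.ncard_lt_ncard ⟨D.left_subset, fun h ↦ lt_irrefl _ (h D.mem).2⟩ (Set.toFinite _)

lemma Division.ncard_right_lt [Finite V] {f : V → ℤ} {a b a' : V} (D : Division G f a b a') :
    (between f a' b).ncard < (between f a b).ncard :=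
  Set.ncard_lt_ncard ⟨D.right_subset, fun h ↦ lt_irrefl _ (h D.mem).1⟩ (Set.toFinite _)

lemma Guarded.exists_division [Finite V] {f : V → ℤ} {a b : V} (h : Guarded G f a b)
    (ha : ∃ z ∈ between f a b, G.Adj a z) : ∃ a', Division G f a b a' := by
  obtain ⟨z, hz, haz⟩ := ha
  obtain ⟨a', ha', hmax⟩ := Set.exists_max_image {z | z ∈ between f a b ∧ G.Adj a z} f
    (Set.toFinite _) ⟨z, hz, haz⟩
  exact ⟨a', h.inj, h.noncrossing, h.confined, ha'.1, ha'.2, fun z hz haz ↦ hmax z ⟨hz, haz⟩⟩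

/-- An edge that leaves a set of vertices of a connected graph. -/
lemma exists_adj_leaving (hconn : G.Connected) {S : Set V} {x y : V} (hx : x ∈ S) (hy : y ∉ S) :
    ∃ u ∈ S, ∃ v ∉ S, G.Adj u v := by
  obtain ⟨p⟩ := hconn.preconnected x y
  obtain ⟨d, -, hd1, hd2⟩ := p.exists_boundary_dart S hx hy
  exact ⟨d.fst, hd1, d.snd, hd2, d.adj⟩

/-- The induction step when `a` is the only exit of the territory. -/
lemma Division.wins_of_roomy_of_single_exit [Finite V] (hconn : G.Connected) {f : V → ℤ}
    {a b a' : V} (D : Division G f a b a')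
    (ih : ∀ (f' : V → ℤ) (a₁ b₁ : V), (between f' a₁ b₁).ncard < (between f a b).ncard →
      Guarded G f' a₁ b₁ → Wins₂ G a₁ b₁ (between f' a₁ b₁))
    (hlt : f a < f b) (hb : ∀ z ∈ between f a b, ¬ G.Adj b z) : Wins₂ G a b (between f a b) := by
  have hbS : b ∉ insert a (between f a b) := by
    rintro (h | h)
    · rw [h] at hlt
      exact lt_irrefl _ hlt
    · exact lt_irrefl _ h.2
  obtain ⟨u, hu, w, hw, huw⟩ := exists_adj_leaving hconn (Set.mem_insert a _) hbS
  have hwZ : w ∉ between f a b := fun h ↦ hw (Or.inr h)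
  have hwa : w ≠ a := fun h ↦ hw (Or.inl h)
  have hub : ∀ z ∈ between f a b, ¬ G.Adj z w := by
    intro z hz hzw
    rcases D.confined z hz w hzw with h | h | h
    · exact hwZ h
    · exact hwa h
    · exact hb z hz (h ▸ hzw.symm)
  obtain rfl : u = a := by
    rcases hu with h | h
    · exact h
    · exact absurd huw (hub u h)
  exact D.wins_of_single_exit hconn
    (ih f _ _ D.ncard_left_lt (D.guarded_left hwZ hwa fun h ↦ hub a' D.mem h.symm))
    (ih f _ _ D.ncard_right_lt (D.guarded_right
      (Or.inr (Or.inr fun z hz ↦ hb z (D.right_subset hz))))) hb huw.symm hwZ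

/-- Two vertices outside the territory between `a` and `b` cannot both be adjacent to both of `a`
and `b`. -/
lemma _root_.Noncrossing.eq_of_adj {f : V → ℤ} (hf : Noncrossing G f) (hinj : Function.Injective f)
    {a b w w' : V} (hab : f a < f b) (hw : w ∉ between f a b) (hw' : w' ∉ between f a b)
    (hwa : G.Adj w a) (hwb : G.Adj w b) (hwa' : G.Adj w' a) (hwb' : G.Adj w' b) : w = w' := by
  have out : ∀ v, v ∉ between f a b → G.Adj v a → G.Adj v b → f v < f a ∨ f b < f v := by
    intro v hv hva hvb
    by_contra! h
    exact hv ⟨lt_of_le_of_ne h.1 fun h' ↦ hva.ne (hinj h').symm,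
      lt_of_le_of_ne h.2 fun h' ↦ hvb.ne (hinj h')⟩
  have main : ∀ v v', v ∉ between f a b → v' ∉ between f a b → G.Adj v a → G.Adj v b →
      G.Adj v' a → G.Adj v' b → ¬ f v < f v' := by
    intro v v' hv hv' hva hvb hva' hvb' hlt
    rcases out v hv hva hvb with h | h
    · rcases out v' hv' hva' hvb' with h' | h'
      · exact hf v v' a b hlt h' hab hva hvb'
      · exact hf v a b v' h hab h' hvb hva'.symm
    · exact hf a b v v' hab h hlt hva.symm hvb'.symm
  rcases lt_trichotomy (f w) (f w') with h | h | h
  · exact absurd h (main w w' hw hw' hwa hwb hwa' hwb')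
  · exact hinj h
  · exact absurd h (main w' w hw' hw hwa' hwb' hwa hwb)

/-- Two cops at `a` and `b` who have room behind them and confine the robber to the territory
between `a` and `b` capture him: they can always force him into a smaller territory, behind which
there is room again. -/
theorem Guarded.wins [Finite V] (hconn : G.Connected) {f : V → ℤ} {a b : V}
    (h : Guarded G f a b) : Wins₂ G a b (between f a b) := by
  induction hN : (between f a b).ncard using Nat.strong_induction_on generalizing f a b with
  | _ N ih =>
  subst hN
  replace ih : ∀ (f' : V → ℤ) (a₁ b₁ : V), (between f' a₁ b₁).ncard < (between f a b).ncard →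
      Guarded G f' a₁ b₁ → Wins₂ G a₁ b₁ (between f' a₁ b₁) :=
    fun f' a₁ b₁ hlt hg ↦ ih _ hlt hg rfl
  have ihn : ∀ (f' : V → ℤ) (a₁ b₁ : V),
      (between f' a₁ b₁).ncard < (between (fun v ↦ -f v) b a).ncard →
      Guarded G f' a₁ b₁ → Wins₂ G a₁ b₁ (between f' a₁ b₁) := by
    rw [between_neg]
    exact ih
  have flip : Wins₂ G b a (between (fun v ↦ -f v) b a) → Wins₂ G a b (between f a b) := by
    rw [between_neg]
    exact Wins₂.swap
  have hna : a ∉ between f a b := fun h ↦ lt_irrefl _ h.1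
  have hnb : b ∉ between f a b := fun h ↦ lt_irrefl _ h.2
  rcases (between f a b).eq_empty_or_nonempty with hZ | ⟨z₀, hz₀⟩
  · rw [hZ]
    exact .empty _
  by_cases ha : ∃ z ∈ between f a b, G.Adj a z
  · obtain ⟨a', D⟩ := h.exists_division ha
    by_cases hb : ∃ z ∈ between f a b, G.Adj b z
    · obtain ⟨w₀, hw₀, hw₀a, hw₀b, hw₀ab⟩ :
          ∃ w ∉ between f a b, w ≠ a ∧ w ≠ b ∧ ¬ (G.Adj w a ∧ G.Adj w b) := by
        rcases h.roomy with h | h | h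
        · exact h
        · obtain ⟨z, hz, haz⟩ := ha
          exact absurd haz (h z hz)
        · obtain ⟨z, hz, hbz⟩ := hb
          exact absurd hbz (h z hz)
      have hw₀a' := D.not_adj_of_notMem hw₀ hw₀a hw₀b
      have h₁ := ih f _ _ D.ncard_left_lt (D.guarded_left hw₀ hw₀a hw₀a')
      have h₂ := ih f _ _ D.ncard_right_lt (D.guarded_right (Or.inl ⟨w₀,
        fun h' ↦ hw₀ (D.right_subset h'), fun h' ↦ hw₀ (h' ▸ D.mem), hw₀b, fun h' ↦ hw₀a' h'.1⟩))
      by_cases hB : ∃ w ∉ between f a b, w ≠ a ∧ G.Adj w b ∧ ¬ G.Adj w a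
      · obtain ⟨w, hw, hwa, hwb, hwna⟩ := hB
        exact D.wins_of_not_adj hconn h₁ h₂ hwb hwna hw hwa
      by_cases hA : ∃ w ∉ between f a b, w ≠ b ∧ G.Adj w a ∧ ¬ G.Adj w b
      · obtain ⟨w, hw, hwb, hwa, hwnb⟩ := hA
        obtain ⟨b', D'⟩ := h.neg.exists_division (by rw [between_neg]; exact hb)
        have hw₀' : w₀ ∉ between (fun v ↦ -f v) b a := by rwa [between_neg]
        have hw₀b' := D'.not_adj_of_notMem hw₀' hw₀b hw₀a
        refine flip (D'.wins_of_not_adj hconn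
          (ihn _ _ _ D'.ncard_left_lt (D'.guarded_left hw₀' hw₀b hw₀b'))
          (ihn _ _ _ D'.ncard_right_lt (D'.guarded_right (Or.inl ⟨w₀,
            fun h' ↦ hw₀' (D'.right_subset h'), fun h' ↦ hw₀' (h' ▸ D'.mem), hw₀a,
            fun h' ↦ hw₀b' h'.1⟩))) hwa hwnb (by rwa [between_neg]) hwb)
      push Not at hA hB
      -- all that is left outside is attached through one common neighbour of `a` and `b`
      have hw₀na : ¬ G.Adj w₀ a := fun h' ↦ hw₀ab ⟨h', hA w₀ hw₀ hw₀b h'⟩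
      obtain ⟨w₂, ⟨hw₂, hw₂a, hw₂b, hw₂na⟩, w, hw, hww⟩ :=
        exists_adj_leaving hconn (S := {v | v ∉ between f a b ∧ v ≠ a ∧ v ≠ b ∧ ¬ G.Adj v a})
          (x := w₀) (y := a) ⟨hw₀, hw₀a, hw₀b, hw₀na⟩ fun h' ↦ h'.2.1 rfl
      have hw₂nb : ¬ G.Adj w₂ b := fun h' ↦ hw₂na (hB w₂ hw₂ hw₂a h')
      have hwZ : w ∉ between f a b := fun h' ↦ by
        rcases h.confined w h' w₂ hww.symm with h | h | h
        exacts [hw₂ h, hw₂a h, hw₂b h]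
      have hwa : w ≠ a := fun h' ↦ hw₂na (h' ▸ hww)
      have hwb : w ≠ b := fun h' ↦ hw₂nb (h' ▸ hww)
      have hwa' : G.Adj w a := by
        by_contra h'
        exact hw ⟨hwZ, hwa, hwb, h'⟩
      have hwb' := hA w hwZ hwb hwa'
      refine D.wins_of_unique hconn h₁ h₂ hwb' (fun v hv ↦ ?_) hww.symm hw₂ hw₂na hw₂nb hw₂a hw₂b
      by_cases hvZ : v ∈ between f a b
      · exact Or.inl hvZ
      by_cases hva : v = a
      · exact Or.inr (Or.inl hva)
      exact Or.inr (Or.inr (h.noncrossing.eq_of_adj h.inj h.lt hvZ hwZ (hB v hvZ hva hv.symm)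
        hv.symm hwa' hwb'))
    · push Not at hb
      exact D.wins_of_roomy_of_single_exit hconn ih h.lt hb
  · push Not at ha
    by_cases hb : ∃ z ∈ between f a b, G.Adj b z
    · obtain ⟨b', D'⟩ := h.neg.exists_division (by rw [between_neg]; exact hb)
      exact flip (D'.wins_of_roomy_of_single_exit hconn ihn h.neg.lt
        (by rw [between_neg]; exact ha))
    · push Not at hb
      exfalso
      obtain ⟨u, hu, v, hv, huv⟩ := exists_adj_leaving hconn hz₀ hna
      rcases h.confined u hu v huv with h | h | h
      · exact hv h
      · exact ha u hu (h ▸ huv.symm)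
      · exact hb u hu (h ▸ huv.symm)

/-- The same for the territory on the other side of `a` and `b`, where the numbering of the polygon
wraps around. -/
theorem wins_of_roomy_outside [Finite V] (hconn : G.Connected) {f : V → ℤ}
    (hinj : Function.Injective f) (hf : Noncrossing G f) {a b : V} (hba : f b < f a) {Z : Set V}
    (hZ : ∀ v, v ∈ Z ↔ f a < f v ∨ f v < f b) (hconf : Confined G Z a b) (hroom : Roomy G Z a b) :
    Wins₂ G a b Z := by
  obtain ⟨N, hN⟩ : ∃ N, ∀ u v, f u - f v < N := by
    obtain ⟨M, hM⟩ := (Set.finite_range fun p : V × V ↦ f p.1 - f p.2).bddAbove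
    exact ⟨M + 1, fun u v ↦ Int.lt_add_one_of_le (hM ⟨(u, v), rfl⟩)⟩
  -- rotate the polygon so that `a` comes first and `b` last
  let g : V → ℤ := fun v ↦ if f v ≤ f b then f v + N else f v
  have hg : ∀ v, f v ≤ f b ∧ g v = f v + N ∨ f b < f v ∧ g v = f v := by
    intro v
    by_cases h : f v ≤ f b
    · exact Or.inl ⟨h, if_pos h⟩
    · exact Or.inr ⟨not_le.1 h, if_neg h⟩
  have hZg : between g a b = Z := by
    ext v
    rw [hZ, between, Set.mem_ofPred_eq]
    have := hN a v
    have := hN v b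
    rcases hg a with ⟨_, h1⟩ | ⟨_, h1⟩ <;> rcases hg b with ⟨_, h2⟩ | ⟨_, h2⟩ <;>
      rcases hg v with ⟨_, h3⟩ | ⟨_, h3⟩ <;> omega
  have hG : Guarded G g a b := {
    inj := by
      intro u v huv
      apply hinj
      have := hN u v
      have := hN v u
      rcases hg u with ⟨_, h1⟩ | ⟨_, h1⟩ <;> rcases hg v with ⟨_, h2⟩ | ⟨_, h2⟩ <;> omega
    noncrossing := by
      intro p q r s hpq hqr hrs hpr hqs
      have := hN q p
      have := hN r q
      have := hN s r
      rcases hg p with ⟨_, h1⟩ | ⟨_, h1⟩ <;> rcases hg q with ⟨_, h2⟩ | ⟨_, h2⟩ <;>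
        rcases hg r with ⟨_, h3⟩ | ⟨_, h3⟩ <;> rcases hg s with ⟨_, h4⟩ | ⟨_, h4⟩ <;>
        first
        | exact hf p q r s (by omega) (by omega) (by omega) hpr hqs
        | exact hf q r s p (by omega) (by omega) (by omega) hqs hpr.symm
        | exact hf r s p q (by omega) (by omega) (by omega) hpr.symm hqs.symm
        | exact hf s p q r (by omega) (by omega) (by omega) hqs.symm hpr
    lt := by
      have := hN a b
      rcases hg a with ⟨_, h1⟩ | ⟨_, h1⟩ <;> rcases hg b with ⟨_, h2⟩ | ⟨_, h2⟩ <;> omega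
    confined := by rw [hZg]; exact hconf
    roomy := by rw [hZg]; exact hroom }
  rw [← hZg]
  exact hG.wins hconn

/-! ### The first moves -/

/-- The two cops have an initial placement from which they win. -/
def HasWinningStart (G : SimpleGraph V) : Prop :=
  ∃ x y, Wins₂ G x y {r | r ≠ x ∧ r ≠ y}

lemma HasWinningStart.copsWin [Finite V] (h : HasWinningStart G) : CopsWin G 2 2 := by
  obtain ⟨x, y, h⟩ := h
  refine Wins.copsWin (c := ![x, y]) (Wins.mono ?_ h)
  intro r hr
  exact ⟨(hr 0).symm, (hr 1).symm⟩

/-- If the cops can occupy the exits `x` and `y` of `Z` in one move, and the robber is in `Z` unless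
this move captures him, then he is still in `Z` after his answer. -/
lemma wins_of_step {Z A : Set V} {x y x₀ y₀ : V} (hZ : Confined G Z x y) (h : Wins₂ G x y Z)
    (hx : Step G x₀ x) (hy : Step G y₀ y) (hA : ∀ r ∈ A, r ≠ x → r ≠ y → r ∈ Z) :
    Wins₂ G x₀ y₀ A := by
  refine Wins₂.move x y Z hx hy ?_ h
  rintro r hr h1 h2 r' (rfl | hrr') h3 h4
  · exact hA _ hr h1 h2
  · rcases hZ r (hA r hr h1 h2) r' hrr' with h | h | h
    exacts [h, absurd h h3, absurd h h4]

/-- The vertices outside the interval from `b` to `a` of the numbering `f`: the other side of `a`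
and `b` in the polygon. -/
def outside (f : V → ℤ) (a b : V) : Set V := {v | f a < f v ∨ f v < f b}

lemma mem_outside {f : V → ℤ} {a b v : V} : v ∈ outside f a b ↔ f a < f v ∨ f v < f b := Iff.rfl

/-- A stretch of at least four consecutive vertices whose inner vertices have neighbours only in the
stretch and at distance at most two along it. A shortest edge that skips at least two vertices spans
such a stretch; if there is no such edge, all vertices together are one. -/
lemma exists_stretch [Finite V] {f : V → ℤ} (hf : Noncrossing G f) {n : ℕ} (hn : 4 ≤ n)
    (hrange : ∀ v, 0 ≤ f v ∧ f v < n) :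
    ∃ l k : ℤ, 0 ≤ l ∧ 3 ≤ k ∧ l + k < n ∧ ∀ u v, l < f u → f u < l + k → G.Adj u v →
      l ≤ f v ∧ f v ≤ l + k ∧ f v ≤ f u + 2 ∧ f u ≤ f v + 2 := by
  rcases Set.eq_empty_or_nonempty {p : V × V | G.Adj p.1 p.2 ∧ f p.1 + 3 ≤ f p.2} with h | h
  · have hshort : ∀ u v, G.Adj u v → f v < f u + 3 := by
      intro u v huv
      by_contra! h'
      exact Set.notMem_empty (u, v) (h ▸ ⟨huv, h'⟩)
    refine ⟨0, n - 1, le_rfl, by omega, by omega, fun u v _ _ huv ↦ ?_⟩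
    have := hshort u v huv
    have := hshort v u huv.symm
    have := hrange v
    omega
  · obtain ⟨⟨a, b⟩, ⟨hab, hlen⟩, hmin⟩ :=
      Set.exists_min_image _ (fun p : V × V ↦ f p.2 - f p.1) (Set.toFinite _) h
    simp only at hlen hab
    have hmin' : ∀ u v, G.Adj u v → f u + 3 ≤ f v → f b - f a ≤ f v - f u :=
      fun u v huv hlt ↦ hmin (u, v) ⟨huv, hlt⟩
    have := hrange a
    have := hrange b
    refine ⟨f a, f b - f a, by omega, by omega, by omega, fun u v hu hu' huv ↦ ?_⟩
    have h1 : ¬ f v < f a := fun h' ↦ hf v a u b h' hu (by omega) huv.symm hab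
    have h2 : ¬ f b < f v := fun h' ↦ hf a u b v hu (by omega) h' hab huv
    have h3 := hmin' u v huv
    have h4 := hmin' v u huv.symm
    omega

section Start

variable {f : V → ℤ} (hinj : Function.Injective f)
include hinj

lemma confined_outside {a b : V}
    (h : ∀ u v, f b < f u → f u < f a → G.Adj u v → f b ≤ f v ∧ f v ≤ f a) :
    Confined G (outside f a b) a b := by
  intro z hz v hzv
  by_cases h1 : v ∈ outside f a b
  · exact Or.inl h1
  rw [mem_outside] at h1 hz
  by_cases h2 : f v = f a
  · exact Or.inr (Or.inl (hinj h2))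
  by_cases h3 : f v = f b
  · exact Or.inr (Or.inr (hinj h3))
  have := h v z (by omega) (by omega) hzv.symm
  omega

/-- If `a` is adjacent to no vertices but `b` and `a'`, the cops can start from a win at `a'` and
`b` against a robber outside. -/
lemma hasWinningStart_of_wins (hconn : G.Connected) {b a a' : V}
    (h₁ : f a = f b + 1) (h₂ : f a' = f b + 2)
    (ha : ∀ v, G.Adj a v → f v = f b ∨ f v = f a') (h : Wins₂ G a' b (outside f a' b)) :
    HasWinningStart G := by
  have hconf : Confined G (outside f a' b) a' b := confined_outside hinj fun u v hu hu' huv ↦ by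
    obtain rfl : u = a := hinj (by omega)
    rcases ha v huv with h | h <;> omega
  have hout : ∀ r, r ≠ a → r ≠ b → r ≠ a' → r ∈ outside f a' b := by
    intro r h1 h2 h3
    have h1' := hinj.ne h1
    have h2' := hinj.ne h2
    have h3' := hinj.ne h3
    rw [mem_outside]
    omega
  have hab : a ∉ ({b} : Set V) := fun h' ↦ by
    rw [Set.mem_singleton_iff] at h'
    subst h'
    omega
  have hex : ∃ v, G.Adj a v := by
    obtain ⟨u, hu, v, -, huv⟩ := exists_adj_leaving hconn (Set.mem_singleton a)
      (fun h' : b ∈ ({a} : Set V) ↦ hab (Set.mem_singleton_iff.1 h').symm)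
    rw [Set.mem_singleton_iff] at hu
    exact ⟨v, hu ▸ huv⟩
  obtain ⟨v, hav⟩ := hex
  rcases ha v hav with hv | hv
  · rw [hinj hv] at hav
    exact ⟨a', a, wins_of_step hconf h (Or.inl rfl) (Or.inr hav)
      fun r hr _ h2 ↦ hout r hr.2 h2 hr.1⟩
  · rw [hinj hv] at hav
    exact ⟨a, b, wins_of_step hconf h (Or.inr hav) (Or.inl rfl)
      fun r hr h1 _ ↦ hout r hr.1 hr.2 h1⟩

variable (hf : Noncrossing G f)
include hf

lemma hasWinningStart_of_roomy [Finite V] (hconn : G.Connected) {b a a' : V}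
    (h₁ : f a = f b + 1) (h₂ : f a' = f b + 2)
    (ha : ∀ v, G.Adj a v → f v = f b ∨ f v = f a') (hroom : Roomy G (outside f a' b) a' b) :
    HasWinningStart G :=
  hasWinningStart_of_wins hinj hconn h₁ h₂ ha
    (wins_of_roomy_outside hconn hinj hf (by omega) (fun _ ↦ mem_outside)
      (confined_outside hinj fun u v hu hu' huv ↦ by
        obtain rfl : u = a := hinj (by omega)
        rcases ha v huv with h | h <;> omega) hroom)

lemma hasWinningStart_of_not_adj [Finite V] (hconn : G.Connected) {b a a' : V}
    (h₁ : f a = f b + 1) (h₂ : f a' = f b + 2)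
    (ha : ∀ v, G.Adj a v → f v = f b ∨ f v = f a') (h : ¬ (G.Adj a a' ∧ G.Adj a b)) :
    HasWinningStart G :=
  hasWinningStart_of_roomy hinj hf hconn h₁ h₂ ha (Or.inl ⟨a, fun h' ↦ by
    rw [mem_outside] at h'; omega, fun h' ↦ by rw [h'] at h₁; omega,
    fun h' ↦ by rw [h'] at h₁; omega, h⟩)

/-- The cops can start at two consecutive vertices `a` and `a'` if `a` has no neighbours but those
next to it and `a'` has at most one neighbour more, next to `a` too. -/
lemma hasWinningStart_of_consecutive [Finite V] (hconn : G.Connected) {b a a' a'' : V}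
    (h₁ : f a = f b + 1) (h₂ : f a' = f b + 2) (h₃ : f a'' = f b + 3)
    (ha : ∀ v, G.Adj a v → f v = f b ∨ f v = f a')
    (ha' : ∀ v, G.Adj a' v → f v = f b ∨ f v = f a ∨ f v = f a'') : HasWinningStart G := by
  by_cases h4 : G.Adj a' a''
  swap
  · refine hasWinningStart_of_roomy hinj hf hconn h₁ h₂ ha (Or.inr (Or.inl fun z hz haz ↦ ?_))
    rw [mem_outside] at hz
    rcases ha' z haz with h | h | h
    · omega
    · omega
    · exact h4 (hinj h ▸ haz)
  refine hasWinningStart_of_wins hinj hconn h₁ h₂ ha ?_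
  have hconf : Confined G (outside f a'' b) a'' b := confined_outside hinj fun u v hu hu' huv ↦ by
    have h5 : f u = f a ∨ f u = f a' := by omega
    rcases h5 with h5 | h5
    · rcases ha v (hinj h5 ▸ huv) with h | h <;> omega
    · rcases ha' v (hinj h5 ▸ huv) with h | h | h <;> omega
  refine wins_of_step hconf (wins_of_roomy_outside hconn hinj hf (by omega) (fun _ ↦ mem_outside)
    hconf (Or.inl ⟨a, ?_, ?_, ?_, ?_⟩)) (Or.inr h4) (Or.inl rfl) ?_
  · rw [mem_outside]
    omega
  · rintro rfl
    omega
  · rintro rfl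
    omega
  · rintro ⟨h, -⟩
    rcases ha _ h with h | h <;> omega
  · intro r hr h5 _
    have := hinj.ne h5
    rw [mem_outside] at hr ⊢
    omega

/-- Two triangles `p₀p₁p₂` and `p₂p₃p₄` whose vertices `p₁` and `p₃` have degree two, at a common
vertex `p₂` of degree four: the cops can clear them without any sight of the robber. -/
lemma hasWinningStart_of_two_ears [Finite V] (hconn : G.Connected) {p₀ p₁ p₂ p₃ p₄ : V}
    (e₁ : f p₁ = f p₀ + 1) (e₂ : f p₂ = f p₀ + 2) (e₃ : f p₃ = f p₀ + 3) (e₄ : f p₄ = f p₀ + 4)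
    (h₁ : ∀ v, G.Adj p₁ v → f v = f p₀ ∨ f v = f p₂)
    (h₂ : ∀ v, G.Adj p₂ v → f v = f p₀ ∨ f v = f p₁ ∨ f v = f p₃ ∨ f v = f p₄)
    (h₃ : ∀ v, G.Adj p₃ v → f v = f p₂ ∨ f v = f p₄)
    (h₁₀ : G.Adj p₁ p₀) (h₀₂ : G.Adj p₀ p₂) (h₂₄ : G.Adj p₂ p₄) (h₃₄ : G.Adj p₃ p₄) :
    HasWinningStart G := by
  have hconf : Confined G (outside f p₄ p₀) p₄ p₀ := confined_outside hinj fun u v hu hu' huv ↦ by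
    have h5 : f u = f p₁ ∨ f u = f p₂ ∨ f u = f p₃ := by omega
    rcases h5 with h5 | h5 | h5
    · rcases h₁ v (hinj h5 ▸ huv) with h | h <;> omega
    · rcases h₂ v (hinj h5 ▸ huv) with h | h | h | h <;> omega
    · rcases h₃ v (hinj h5 ▸ huv) with h | h <;> omega
  have hwin : Wins₂ G p₄ p₀ (outside f p₄ p₀) := by
    refine wins_of_roomy_outside hconn hinj hf (by omega) (fun _ ↦ mem_outside) hconf
      (Or.inl ⟨p₁, ?_, ?_, ?_, ?_⟩)
    · rw [mem_outside]
      omega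
    · rintro rfl
      omega
    · rintro rfl
      omega
    · rintro ⟨h, -⟩
      rcases h₁ _ h with h | h <;> omega
  have hto : ∀ r, Step G r p₁ → r ≠ p₁ → r = p₀ ∨ r = p₂ := by
    rintro r (h | h) hr
    · exact absurd h.symm hr
    · rcases h₁ r h.symm with h | h
      exacts [Or.inl (hinj h), Or.inr (hinj h)]
  refine ⟨p₁, p₂, Wins₂.move p₀ p₂ {r | r ≠ p₀ ∧ r ≠ p₁ ∧ r ≠ p₂} (Or.inr h₁₀) (Or.inl rfl) ?_ ?_⟩
  · rintro r ⟨hr1, -⟩ hr0 hr2 r' hrr' hr0' hr2'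
    refine ⟨hr0', ?_, hr2'⟩
    rintro rfl
    rcases hto r hrr' hr1 with h | h
    exacts [hr0 h, hr2 h]
  refine Wins₂.move p₂ p₄ {r | r ≠ p₁ ∧ r ≠ p₂ ∧ r ≠ p₄} (Or.inr h₀₂) (Or.inr h₂₄) ?_ ?_
  · rintro r ⟨hr0, hr1, -⟩ hr2 - r' hrr' hr2' hr4'
    refine ⟨?_, hr2', hr4'⟩
    rintro rfl
    rcases hto r hrr' hr1 with h | h
    exacts [hr0 h, hr2 h]
  refine Wins₂.move p₀ p₃ (insert p₄ (outside f p₄ p₀)) (Or.inr h₀₂.symm) (Or.inr h₃₄.symm) ?_ ?_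
  · rintro r ⟨hr1, hr2, hr4⟩ hr0 hr3 r' hrr' hr0' -
    have hr : r ∈ outside f p₄ p₀ := by
      have := hinj.ne hr0
      have := hinj.ne hr1
      have := hinj.ne hr2
      have := hinj.ne hr3
      have := hinj.ne hr4
      rw [mem_outside]
      omega
    rcases hrr' with rfl | hrr'
    · exact Or.inr hr
    · rcases hconf r hr r' hrr' with h | h | h
      exacts [Or.inr h, Or.inl h, absurd h hr0']
  · refine wins_of_step hconf.symm hwin.swap (Or.inl rfl) (Or.inr h₃₄) ?_
    rintro r (h | h) - h4
    · exact absurd h h4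
    · exact h

/-- At the beginning `p₀, p₁, p₂, …` of a stretch as in `exists_stretch`, edges that skip a vertex
do not cross. If one of the pairs `p₁p₂` and `p₂p₃` is as in `hasWinningStart_of_consecutive`, the
cops start there; otherwise `p₀p₂` and `p₂p₄` are edges, which cut off `p₁` and `p₃`, and the cops
clear these two triangles. -/
theorem hasWinningStart_of_four_le [Finite V] (hconn : G.Connected) {n : ℕ} (hn : 4 ≤ n)
    (hrange : ∀ v, 0 ≤ f v ∧ f v < n) (hsurj : ∀ i : ℤ, 0 ≤ i → i < n → ∃ v, f v = i) :
    HasWinningStart G := by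
  obtain ⟨l, k, hl, hk, hlk, hst⟩ := exists_stretch hf hn hrange
  obtain ⟨p₀, e₀⟩ := hsurj l (by omega) (by omega)
  obtain ⟨p₁, e₁⟩ := hsurj (l + 1) (by omega) (by omega)
  obtain ⟨p₂, e₂⟩ := hsurj (l + 2) (by omega) (by omega)
  obtain ⟨p₃, e₃⟩ := hsurj (l + 3) (by omega) (by omega)
  have n₁ : ∀ v, G.Adj p₁ v → f v = l ∨ f v = l + 2 ∨ f v = l + 3 := by
    intro v hv
    have := hst p₁ v (by omega) (by omega) hv
    have := hinj.ne hv.ne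
    omega
  have n₂ : ∀ v, G.Adj p₂ v →
      f v = l ∨ f v = l + 1 ∨ f v = l + 3 ∨ f v = l + 4 ∧ l + 4 ≤ l + k := by
    intro v hv
    have := hst p₂ v (by omega) (by omega) hv
    have := hinj.ne hv.ne
    omega
  have hinj' : Function.Injective fun v ↦ -f v := fun _ _ huv ↦ hinj (neg_injective huv)
  by_cases h₁₃ : G.Adj p₁ p₃
  · -- `p₂` is shut in by the edge `p₁p₃`
    refine hasWinningStart_of_consecutive hinj' hf.neg hconn (b := p₃) (a := p₂) (a' := p₁)
      (a'' := p₀) (by omega) (by omega) (by omega) (fun v hv ↦ ?_) (fun v hv ↦ ?_)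
    · have h1 : ¬ f v < l + 1 := fun h ↦
        hf v p₁ p₂ p₃ (by omega) (by omega) (by omega) hv.symm h₁₃
      have h2 : ¬ l + 3 < f v := fun h ↦
        hf p₁ p₂ p₃ v (by omega) (by omega) (by omega) h₁₃ hv
      have := n₂ v hv
      omega
    · have := n₁ v hv
      omega
  have n₁' : ∀ v, G.Adj p₁ v → f v = l ∨ f v = l + 2 := by
    intro v hv
    rcases n₁ v hv with h | h | h
    · exact Or.inl h
    · exact Or.inr h
    · exact absurd (hinj (h.trans e₃.symm) ▸ hv) h₁₃
  by_cases h₂₄ : ∃ p₄, f p₄ = l + 4 ∧ G.Adj p₂ p₄ ∧ 4 ≤ k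
  swap
  · refine hasWinningStart_of_consecutive hinj hf hconn (b := p₀) (a := p₁) (a' := p₂)
      (a'' := p₃) (by omega) (by omega) (by omega) (fun v hv ↦ ?_) (fun v hv ↦ ?_)
    · have := n₁' v hv
      omega
    · rcases n₂ v hv with h | h | h | h
      · omega
      · omega
      · omega
      · exact absurd ⟨v, h.1, hv, by omega⟩ h₂₄
  obtain ⟨p₄, e₄, h₂₄, hk4⟩ := h₂₄
  -- `p₃` is shut in by the edge `p₂p₄`
  have n₃ : ∀ v, G.Adj p₃ v → f v = l + 2 ∨ f v = l + 4 := by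
    intro v hv
    have h1 : ¬ f v < l + 2 := fun h ↦
      hf v p₂ p₃ p₄ (by omega) (by omega) (by omega) hv.symm h₂₄
    have h2 : ¬ l + 4 < f v := fun h ↦
      hf p₂ p₃ p₄ v (by omega) (by omega) (by omega) h₂₄ hv
    have := hinj.ne hv.ne
    omega
  by_cases h₀₂ : G.Adj p₀ p₂
  swap
  · refine hasWinningStart_of_consecutive hinj' hf.neg hconn (b := p₄) (a := p₃) (a' := p₂)
      (a'' := p₁) (by omega) (by omega) (by omega) (fun v hv ↦ ?_) (fun v hv ↦ ?_)
    · have := n₃ v hv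
      omega
    · rcases n₂ v hv with h | h | h | h
      · exact absurd (hinj (h.trans e₀.symm) ▸ hv).symm h₀₂
      · omega
      · omega
      · omega
  by_cases h₁ : G.Adj p₁ p₂ ∧ G.Adj p₁ p₀
  swap
  · exact hasWinningStart_of_not_adj hinj hf hconn (b := p₀) (a := p₁) (a' := p₂) (by omega)
      (by omega) (fun v hv ↦ by have := n₁' v hv; omega) h₁
  by_cases h₃ : G.Adj p₃ p₄ ∧ G.Adj p₃ p₂
  swap
  · exact hasWinningStart_of_not_adj hinj hf hconn (b := p₂) (a := p₃) (a' := p₄) (by omega)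
      (by omega) (fun v hv ↦ by have := n₃ v hv; omega) h₃
  refine hasWinningStart_of_two_ears hinj hf hconn (p₀ := p₀) (p₁ := p₁) (p₂ := p₂) (p₃ := p₃)
    (p₄ := p₄) (by omega) (by omega) (by omega) (by omega) (fun v hv ↦ ?_) (fun v hv ↦ ?_)
    (fun v hv ↦ ?_) h₁.2 h₀₂ h₂₄ h₃.1
  · have := n₁' v hv
    omega
  · have := n₂ v hv
    omega
  · have := n₃ v hv
    omega

end Start

/-- With at most three vertices, the cops start at all of them, or at all but one that is adjacent
to a cop. -/
lemma hasWinningStart_of_card_le_three [Finite V] (hconn : G.Connected) (h : Nat.card V ≤ 3) :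
    HasWinningStart G := by
  obtain ⟨z⟩ := hconn.nonempty
  by_cases hz : ∃ x, G.Adj x z
  · obtain ⟨x, hxz⟩ := hz
    obtain ⟨y, hy⟩ : ∃ y, ∀ v, v = x ∨ v = z ∨ v = y := by
      by_contra! hne
      obtain ⟨y, hyx, hyz, -⟩ := hne x
      obtain ⟨v, hvx, hvz, hvy⟩ := hne y
      have h4 : ({x, z, y, v} : Set V).ncard = 4 := by
        rw [Set.ncard_insert_of_notMem (by simp [hxz.ne, hyx.symm, hvx.symm]),
          Set.ncard_insert_of_notMem (by simp [hyz.symm, hvz.symm]),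
          Set.ncard_insert_of_notMem (by simp [hvy.symm]), Set.ncard_singleton]
      have := Set.ncard_le_card ({x, z, y, v} : Set V)
      omega
    refine ⟨x, y, Wins₂.move z y ∅ (Or.inr hxz) (Or.inl rfl) ?_ (.empty _)⟩
    rintro r ⟨hrx, -⟩ hrz hry
    rcases hy r with h | h | h
    exacts [absurd h hrx, absurd h hrz, absurd h hry]
  · refine ⟨z, z, Wins.mono ?_ (.empty _)⟩
    rintro r ⟨hr, -⟩
    obtain ⟨u, hu, v, -, huv⟩ := exists_adj_leaving hconn (Set.mem_singleton z)
      (y := r) (by simpa using hr)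
    rw [Set.mem_singleton_iff] at hu
    exact hz ⟨v, hu ▸ huv.symm⟩

end HyperopicGame

theorem mainTheorem4 {V : Type*} [Finite V] (G : SimpleGraph V) (hconn : G.Connected)
    (hout : IsOuterplanar G) : HyperopicGame.hyperopicCopNumber G 2 ≤ 2 := by
  have hstart : HyperopicGame.HasWinningStart G := by
    rcases Nat.lt_or_ge (Nat.card V) 4 with hn | hn
    · exact HyperopicGame.hasWinningStart_of_card_le_three hconn (by omega)
    · obtain ⟨e, he⟩ := hout.exists_noncrossing
      refine HyperopicGame.hasWinningStart_of_four_le ?_ he hconn hn ?_ ?_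
      · intro u v huv
        simp only [Nat.cast_inj] at huv
        exact e.injective (Fin.ext huv)
      · intro v
        have := (e v).isLt
        omega
      · intro i hi hin
        refine ⟨e.symm ⟨i.toNat, by omega⟩, ?_⟩
        simp [hi]
  exact iInf₂_le_of_le 2 hstart.copsWin le_rfl
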